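/- Let $L^2=L^2(\partial\mathbb D,\frac{d\theta}{2\pi})$ and $L^\infty=L^\infty(\partial\mathbb D)$ on the unit circle, let $H^2\subset L^2$ be the Hardy space (functions whose negative Fourier coefficients vanish), $H^\infty=H^2\cap L^\infty$, and let $P:L^2\to H^2$ be the orthogonal projection. For $\varphi\in L^\infty$ let $T_\varphi:H^2\to H^2$, $T_\varphi p=P(\varphi p)$, be the Toeplitz operator with symbol $\varphi$, let $\operatorname{sp}(T_\varphi)$ be its spectrum, and let $\varphi(0)$ denote the value at $0$ of the harmonic (Poisson) extension of $\varphi$ to the unit disk. Suppose $\varphi\in L^\infty$ and $\varphi=f+\overline{T_{\bar h}f}$ for some $f,h\in H^\infty$ with $\|h\|_\infty\le 1$ and $h(0)=0$. Then the planar Lebesgue measure of the spectrum satisfies $$\operatorname{Area}(\operatorname{sp}(T_\varphi))\ \ge\ \pi\,\|P(\varphi)-\varphi(0)\|_2^2 .$$ -/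

import Mathlib

open MeasureTheory
open scoped ENNReal

namespace HardyToeplitz

noncomputable section

instance fact_two_pi_pos : Fact (0 < 2 * Real.pi) := ⟨Real.two_pi_pos⟩

/-- The unit circle `∂𝔻`, parametrised by the angle `θ ∈ ℝ/2πℤ` (the point being `e^{iθ}`). -/
abbrev UCircle : Type := AddCircle (2 * Real.pi)

/-- The normalized arc length measure `dθ/2π` on the unit circle. -/
abbrev arc : Measure UCircle := AddCircle.haarAddCircle

/-- `L²(∂𝔻, dθ/2π)`. -/
abbrev L2 : Type := Lp ℂ 2 arc

/-- `L^∞(∂𝔻)`. -/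
abbrev Linf : Type := Lp ℂ ∞ arc

/-- The Hardy space `H²`: the functions in `L²(∂𝔻)` all of whose negative Fourier coefficients
vanish (that is, boundary functions of analytic functions with square summable coefficients). -/
def H2 : Submodule ℂ L2 where
  carrier := {f | ∀ n : ℤ, n < 0 → fourierCoeff (f : UCircle → ℂ) n = 0}
  zero_mem' := by
    intro n _
    rw [← fourierBasis_repr, map_zero]
    rfl
  add_mem' := by
    intro f g hf hg n hn
    have h1 := hf n hn
    have h2 := hg n hn
    rw [← fourierBasis_repr] at h1 h2 ⊢
    rw [map_add, lp.coeFn_add, Pi.add_apply, h1, h2, add_zero]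
  smul_mem' := by
    intro c f hf n hn
    have h1 := hf n hn
    rw [← fourierBasis_repr] at h1 ⊢
    rw [map_smul, lp.coeFn_smul, Pi.smul_apply, h1, smul_zero]

theorem mem_H2 {f : L2} : f ∈ H2 ↔ ∀ n : ℤ, n < 0 → fourierCoeff (f : UCircle → ℂ) n = 0 :=
  Iff.rfl

theorem isClosed_H2 : IsClosed (H2 : Set L2) := by
  have h : (H2 : Set L2) = ⋂ n : ℤ, ⋂ _ : n < 0,
      {f : L2 | inner ℂ (fourierBasis (T := 2 * Real.pi) n) f = 0} := by
    ext f
    simp only [SetLike.mem_coe, mem_H2, Set.mem_iInter, Set.mem_ofPred_eq,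
      ← HilbertBasis.repr_apply_apply, fourierBasis_repr]
  rw [h]
  exact isClosed_iInter fun n => isClosed_iInter fun _ =>
    isClosed_eq (continuous_const.inner continuous_id) continuous_const

instance completeSpace_H2 : CompleteSpace H2 := isClosed_H2.completeSpace_coe

/-- The orthogonal projection `P` from `L²` onto `H²`. -/
def rieszProj : L2 →L[ℂ] H2 := H2.orthogonalProjectionOnto

/-- The inclusion of `L^∞(∂𝔻)` in `L²(∂𝔻)`. -/
def toL2 (f : Linf) : L2 := ((Lp.memLp f).mono_exponent le_top).toLp f

theorem coeFn_toL2 (f : Linf) : (toL2 f : UCircle → ℂ) =ᵐ[arc] f := MemLp.coeFn_toLp _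

/-- `H^∞ = L^∞ ∩ H²`, as a set of functions in `L^∞(∂𝔻)`. -/
def Hinf : Set Linf := {f | toL2 f ∈ H2}

/-- A function in `H^∞`, seen as an element of `H²`. -/
def Hinf.toH2 (f : Hinf) : H2 := ⟨toL2 f, f.2⟩

/-- The Toeplitz operator `T_φ : H² → H²`, `T_φ p = P (φ p)`, with symbol `φ ∈ L^∞`. -/
def toeplitz (φ : Linf) : H2 →L[ℂ] H2 :=
  rieszProj ∘L ((ContinuousLinearMap.mul ℂ ℂ).holderL arc ∞ 2 2 φ) ∘L H2.subtypeL

theorem toeplitz_apply (φ : Linf) (p : H2) : toeplitz φ p = rieszProj (φ • (p : L2)) := rfl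

/-- The harmonic extension (Poisson integral) to the open unit disk of a function on the unit
circle; on `H²` this is the analytic extension. -/
def poissonExt (φ : UCircle → ℂ) (w : ℂ) : ℂ :=
  ∫ t, (poissonKernel 0 w (fourier 1 t) : ℂ) * φ t ∂arc

end

end HardyToeplitz

/-! Write φ = f + ḡ with g = T_{h̄} f, let Q project L² onto (H²)ᗮ, and let F = (f - f(0))/z be the
backward shift of f. The theorem combines a rank-one lower bound for the self-commutator of T_φ with
Putnam's inequality.

Lower bound (`sq_norm_inner_le_commForm`): ‖T_φ p‖² - ‖T_φ* p‖² = ‖Q(φ̄ p)‖² - ‖Q(φ p)‖². Here Q(φ̄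
p) = Q(f̄ p) = u, and ḡ differs from h f̄ by an element of H^∞, so Q(φ p) = Q(h u). The compression
of h to (H²)ᗮ is a contraction that kills e^{-iθ} because h(0) = 0, so the difference is at least
|⟨e^{-iθ}, u⟩|² = |⟨F, p⟩|². Thus T_φ is hyponormal, and p = F/‖F‖ gives ‖F‖² = ‖P(φ) - φ(0)‖².

Putnam (`putnam_inequality`): by the Berger–Shaw trace argument, an operator that moves a Krylov
space by only one dimension has self-commutator trace at most ‖A‖² there. Apply this to T ⊕ ⨁ (a + τ
r_a S), with S a non-unitary isometry and the disks D(a, r_a) disjoint, off the spectrum, and inside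
the disk of radius ‖T‖. Polynomials separate the summands, so the unit vectors chosen in them can be
approximated from a single Krylov space. Each disk contributes τ² r_a²; letting τ → 1 and filling
the complement of the spectrum by a covering theorem leaves exactly the area of the spectrum. -/

namespace HyponormalOperator

/-! ### Trace estimate on Krylov spaces (cyclic Berger–Shaw) -/

noncomputable section

open ContinuousLinearMap

variable {H : Type*} [NormedAddCommGroup H] [InnerProductSpace ℂ H]

/-- The subspace `span {y, A y, …, A ^ d y}`. -/
def krylov (A : H →L[ℂ] H) (y : H) (d : ℕ) : Submodule ℂ H :=
  Submodule.span ℂ (Set.range fun k : Fin d => (A ^ (k : ℕ)) y)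

instance (A : H →L[ℂ] H) (y : H) (d : ℕ) : FiniteDimensional ℂ (krylov A y d) :=
  FiniteDimensional.span_of_finite ℂ (Set.finite_range _)

theorem pow_apply_mem_krylov (A : H →L[ℂ] H) (y : H) {d k : ℕ} (hk : k < d) :
    (A ^ k) y ∈ krylov A y d :=
  Submodule.subset_span ⟨⟨k, hk⟩, rfl⟩

theorem aeval_mem_krylov (A : H →L[ℂ] H) (y : H) {d : ℕ} (p : Polynomial ℂ)
    (hp : p.natDegree < d) : Polynomial.aeval A p y ∈ krylov A y d := by
  rw [Polynomial.aeval_eq_sum_range, sum_apply]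
  refine Submodule.sum_mem _ fun k hk => ?_
  rw [smul_apply]
  exact Submodule.smul_mem _ _ (pow_apply_mem_krylov A y (by
    have := Finset.mem_range.1 hk
    omega))

/-- The space is spanned by d vectors, so only A^{d-1} y can leave it under A, and it leaves in the
single direction of the component of A^d y orthogonal to the space. -/
theorem krylov_raise (A : H →L[ℂ] H) (y : H) (d : ℕ) :
    ∃ w : H, ‖w‖ ≤ 1 ∧ ∀ m ∈ krylov A y d,
      ‖A m‖ ^ 2 ≤ ‖(krylov A y d).starProjection (A m)‖ ^ 2 + ‖inner ℂ w (A m)‖ ^ 2 := by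
  set M := krylov A y d with hM
  set z := (A ^ d) y
  set w₀ := z - M.starProjection z with hw₀
  have hw₀M : ∀ m ∈ M, inner ℂ w₀ m = 0 := fun m hm => by
    rw [← inner_conj_symm, (Submodule.mem_orthogonal M w₀).1
      (M.sub_starProjection_mem_orthogonal z) m hm, map_zero]
  have hdec : ∀ m ∈ M, ∃ m' ∈ M, ∃ c : ℂ, A m = m' + c • w₀ := fun m hm => by
    rw [hM, krylov] at hm
    induction hm using Submodule.span_induction with
    | mem v hv =>
      obtain ⟨k, rfl⟩ := hv
      have hk : A ((A ^ (k : ℕ)) y) = (A ^ ((k : ℕ) + 1)) y := by rw [pow_succ']; rfl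
      dsimp only
      rw [hk]
      rcases Nat.lt_or_ge ((k : ℕ) + 1) d with h | h
      · exact ⟨_, pow_apply_mem_krylov A y h, 0, by simp⟩
      · have : (k : ℕ) + 1 = d := le_antisymm k.2 h
        rw [this]
        exact ⟨M.starProjection z, M.starProjection_apply_mem z, 1, by simp [hw₀, z]⟩
    | zero => exact ⟨0, M.zero_mem, 0, by simp⟩
    | add u v _ _ hu hv =>
      obtain ⟨u', hu', c, hc⟩ := hu
      obtain ⟨v', hv', e, he⟩ := hv
      exact ⟨u' + v', M.add_mem hu' hv', c + e, by rw [map_add, hc, he]; module⟩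
    | smul a v _ hv =>
      obtain ⟨v', hv', e, he⟩ := hv
      exact ⟨a • v', M.smul_mem a hv', a * e, by rw [map_smul, he]; module⟩
  -- If the space is already invariant then w₀ = 0 and, since 0⁻¹ = 0, the witness is 0; hence only
  -- ‖w‖ ≤ 1 is claimed.
  refine ⟨((‖w₀‖⁻¹ : ℝ) : ℂ) • w₀, ?_, fun m hm => ?_⟩
  · rw [norm_smul]
    simpa using inv_mul_le_one
  · obtain ⟨m', hm', c, hc⟩ := hdec m hm
    have hP : M.starProjection (A m) = m' := by
      rw [hc, map_add, map_smul, Submodule.starProjection_eq_self_iff.2 hm',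
        (Submodule.starProjection_apply_eq_zero_iff M).2
          (M.sub_starProjection_mem_orthogonal z), smul_zero, add_zero]
    have hin : ‖inner ℂ (((‖w₀‖⁻¹ : ℝ) : ℂ) • w₀) (A m)‖ = ‖c • w₀‖ := by
      rw [hc, inner_add_right, inner_smul_left, inner_smul_left, hw₀M m' hm', inner_smul_right,
        inner_self_eq_norm_sq_to_K, mul_zero, zero_add, norm_smul, norm_mul, norm_mul]
      by_cases h0 : w₀ = 0
      · simp [h0]
      · have : ‖w₀‖ ≠ 0 := norm_ne_zero_iff.2 h0
        simp
        field_simp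
    rw [hP, hin, hc]
    have horth : inner ℂ m' (c • w₀) = 0 := by
      rw [inner_smul_right, ← inner_conj_symm, hw₀M m' hm', map_zero, mul_zero]
    have := norm_add_sq_eq_norm_sq_add_norm_sq_of_inner_eq_zero m' (c • w₀) horth
    simp only [sq]
    exact this.le

variable [CompleteSpace H]

/-- The quadratic form `x ↦ ⟪[A*, A] x, x⟫ = ‖A x‖² - ‖A* x‖²` of the self-commutator. -/
def commForm (A : H →L[ℂ] H) (x : H) : ℝ := ‖A x‖ ^ 2 - ‖adjoint A x‖ ^ 2

theorem continuous_commForm (A : H →L[ℂ] H) : Continuous (commForm A) := by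
  unfold commForm
  fun_prop

theorem inner_selfCommutator (A : H →L[ℂ] H) (x : H) :
    inner ℂ x ((adjoint A ∘L A - A ∘L adjoint A) x) = commForm A x := by
  simp only [sub_apply, comp_apply, inner_sub_right, adjoint_inner_right, commForm]
  rw [← adjoint_inner_left A (adjoint A x) x, inner_self_eq_norm_sq_to_K, inner_self_eq_norm_sq_to_K]
  push_cast
  rfl

/-- On a finite-dimensional subspace the self-commutator form is diagonal in some orthonormal
basis. -/
theorem exists_orthonormalBasis_commForm (A : H →L[ℂ] H) (M : Submodule ℂ H)
    [FiniteDimensional ℂ M] :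
    ∃ b : OrthonormalBasis (Fin (Module.finrank ℂ M)) ℂ M, ∀ m : M,
      commForm A m = ∑ i, commForm A (b i) * ‖inner ℂ (b i) m‖ ^ 2 := by
  set D : H →L[ℂ] H := adjoint A ∘L A - A ∘L adjoint A with hD
  -- The compression of the self-commutator to M is symmetric; its eigenvectors form the basis.
  set C : M →ₗ[ℂ] M :=
    (M.orthogonalProjectionOnto ∘L D ∘L M.subtypeL : M →L[ℂ] M).toLinearMap with hC
  have hDsa : ∀ x y : H, inner ℂ (D x) y = inner ℂ x (D y) := fun x y => by
    simp only [hD, sub_apply, comp_apply, inner_sub_left, inner_sub_right, adjoint_inner_left,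
      adjoint_inner_right]
    congr 1
    rw [← adjoint_inner_left, ← adjoint_inner_right A]
  have hCin : ∀ m n : M, inner ℂ m (C n) = inner ℂ (m : H) (D n) := fun m n => by
    simp [hC]
  have hsymm : C.IsSymmetric := fun m n => by
    rw [hCin, ← inner_conj_symm, hCin, inner_conj_symm, hDsa]
  have key : ∀ m : M, (inner ℂ m (C m)) = (commForm A m : ℂ) := fun m => by
    rw [hCin, inner_selfCommutator]
  set b := hsymm.eigenvectorBasis rfl
  have hb : ∀ i, C (b i) = (hsymm.eigenvalues rfl i : ℂ) • b i :=
    fun i => hsymm.apply_eigenvectorBasis rfl i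
  have hev : ∀ i, hsymm.eigenvalues rfl i = commForm A (b i) := fun i => by
    have h := key (b i)
    rw [hb, inner_smul_right, inner_self_eq_norm_sq_to_K, b.norm_eq_one] at h
    simpa using h
  refine ⟨b, fun m => ?_⟩
  have h := key m
  rw [← b.sum_inner_mul_inner] at h
  have h2 : ∀ i, inner ℂ m (b i) * inner ℂ (b i) (C m)
      = ((commForm A (b i) * ‖inner ℂ (b i) m‖ ^ 2 : ℝ) : ℂ) := fun i => by
    rw [← hsymm, hb, hev, inner_smul_left, Complex.conj_ofReal, ← inner_conj_symm m]
    push_cast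
    rw [← Complex.conj_mul']
    ring
  simp_rw [h2] at h
  exact_mod_cast h.symm

/-- If `A` raises the dimension of `M` by at most one, the trace of the self-commutator over `M`
is at most `‖A‖ ^ 2`. -/
theorem sum_commForm_starProjection_le (A : H →L[ℂ] H) (hA : ∀ x, 0 ≤ commForm A x)
    (M : Submodule ℂ H) [FiniteDimensional ℂ M] (w : H) (hw : ‖w‖ ≤ 1)
    (hM : ∀ m ∈ M, ‖A m‖ ^ 2 ≤ ‖M.starProjection (A m)‖ ^ 2 + ‖inner ℂ w (A m)‖ ^ 2)
    {ι : Type*} [Fintype ι] (x : ι → H) (hx : Orthonormal ℂ x) :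
    ∑ j, commForm A (M.starProjection (x j)) ≤ ‖A‖ ^ 2 := by
  obtain ⟨b, hb⟩ := exists_orthonormalBasis_commForm A M
  have hbo : Orthonormal ℂ (fun i => (b i : H)) := b.orthonormal.comp_linearIsometry M.subtypeₗᵢ
  have hin : ∀ i (v : H), inner ℂ (b i) (M.orthogonalProjectionOnto v) = inner ℂ (b i : H) v :=
    fun i v => by simp
  have hproj : ∀ v : H, ‖M.starProjection v‖ ^ 2 = ∑ i, ‖inner ℂ (b i : H) v‖ ^ 2 := fun v => by
    have := b.sum_sq_norm_inner_right (M.orthogonalProjectionOnto v)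
    simp_rw [hin] at this
    rw [this]
    rfl
  calc ∑ j, commForm A (M.starProjection (x j))
      = ∑ j, ∑ i, commForm A (b i) * ‖inner ℂ (b i : H) (x j)‖ ^ 2 := by
        refine Finset.sum_congr rfl fun j _ => ?_
        have := hb (M.orthogonalProjectionOnto (x j))
        simp_rw [hin] at this
        exact this
    _ = ∑ i, commForm A (b i) * ∑ j, ‖inner ℂ (b i : H) (x j)‖ ^ 2 := by
        rw [Finset.sum_comm]
        simp_rw [Finset.mul_sum]
    -- Hyponormality makes the weights nonnegative, so Bessel for the family x applies to each unit
    -- vector b i.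
    _ ≤ ∑ i, commForm A (b i) * 1 := by
        refine Finset.sum_le_sum fun i _ => mul_le_mul_of_nonneg_left ?_ (hA _)
        have := hx.sum_inner_products_le (b i : H) (s := Finset.univ)
        have h1 : ‖(b i : H)‖ = 1 := hbo.1 i
        rw [h1, one_pow] at this
        simpa only [norm_inner_symm] using this
    _ = ∑ i, ‖A (b i)‖ ^ 2 - ∑ i, ‖adjoint A (b i)‖ ^ 2 := by
        simp only [mul_one, commForm, Finset.sum_sub_distrib]
    -- The matrix entries of A and of its adjoint inside M have the same total square sum and
    -- cancel; only the part leaving M along w survives.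
    _ ≤ ∑ i, ((∑ k, ‖inner ℂ (b k : H) (A (b i))‖ ^ 2) + ‖inner ℂ w (A (b i))‖ ^ 2)
        - ∑ i, ∑ k, ‖inner ℂ (b k : H) (adjoint A (b i))‖ ^ 2 := by
        refine sub_le_sub (Finset.sum_le_sum fun i _ => ?_) (Finset.sum_le_sum fun i _ => ?_)
        · rw [← hproj]
          exact hM _ (b i).2
        · exact hbo.sum_inner_products_le _ (s := Finset.univ)
    _ = ∑ i, ‖inner ℂ (b i : H) (adjoint A w)‖ ^ 2 := by
        rw [Finset.sum_add_distrib, Finset.sum_comm (f := fun i k =>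
          ‖inner ℂ (b k : H) (adjoint A (b i))‖ ^ 2)]
        simp only [adjoint_inner_right]
        simp_rw [norm_inner_symm w, ← norm_inner_symm (A _)]
        ring
    _ ≤ ‖adjoint A w‖ ^ 2 := hbo.sum_inner_products_le _ (s := Finset.univ)
    _ ≤ ‖A‖ ^ 2 := by
        gcongr
        calc ‖adjoint A w‖ ≤ ‖adjoint A‖ * ‖w‖ := le_opNorm _ _
          _ ≤ ‖A‖ * 1 := by
            rw [LinearIsometryEquiv.norm_map]
            gcongr
          _ = ‖A‖ := mul_one _

/-- The cyclic case of the Berger–Shaw trace inequality: if the orthonormal vectors `x j` are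
approximated by vectors `p(A) y` with `p` polynomial, then `∑ j, ⟪[A*, A] x j, x j⟫ ≤ ‖A‖ ^ 2`. -/
theorem sum_commForm_le_of_approx (A : H →L[ℂ] H) (hA : ∀ x, 0 ≤ commForm A x)
    {ι : Type*} [Fintype ι] (x : ι → H) (hx : Orthonormal ℂ x)
    (y : ℕ → H) (p : ℕ → ι → Polynomial ℂ)
    (hp : ∀ j, Filter.Tendsto (fun N => Polynomial.aeval A (p N j) (y N)) Filter.atTop
      (nhds (x j))) :
    ∑ j, commForm A (x j) ≤ ‖A‖ ^ 2 := by
  -- The cyclic vector may change with N: every estimate is made on the N-th Krylov space, taken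
  -- large enough to contain all the approximants, and the bound ‖A‖² does not depend on N.
  classical
  set d : ℕ → ℕ := fun N => (Finset.univ.sup fun j => (p N j).natDegree) + 1
  set M : ℕ → Submodule ℂ H := fun N => krylov A (y N) (d N)
  have : ∀ N, FiniteDimensional ℂ (M N) := fun N => inferInstanceAs
    (FiniteDimensional ℂ (krylov A (y N) (d N)))
  have hmem : ∀ N j, Polynomial.aeval A (p N j) (y N) ∈ M N := fun N j =>
    aeval_mem_krylov A _ _ (Nat.lt_succ_of_le
      (Finset.le_sup (f := fun j => (p N j).natDegree) (Finset.mem_univ j)))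
  have hlim : ∀ j, Filter.Tendsto (fun N => (M N).starProjection (x j)) Filter.atTop
      (nhds (x j)) := fun j => by
    rw [tendsto_iff_norm_sub_tendsto_zero]
    have h0 := tendsto_iff_norm_sub_tendsto_zero.1 (hp j)
    refine squeeze_zero (fun _ => norm_nonneg _) (fun N => ?_) h0
    have h1 := (M N).starProjection_minimal (x j)
    rw [norm_sub_rev, h1, norm_sub_rev]
    exact ciInf_le ⟨0, by rintro _ ⟨v, rfl⟩; exact norm_nonneg _⟩
      (⟨_, hmem N j⟩ : M N)
  refine le_of_tendsto' (tendsto_finsetSum _ fun j _ =>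
    ((continuous_commForm A).tendsto (x j)).comp (hlim j)) fun N => ?_
  obtain ⟨w, hw, hwM⟩ := krylov_raise A (y N) (d N)
  exact sum_commForm_starProjection_le A hA (M N) w hw hwM x hx

end

end HyponormalOperator

/-! ### Inverses of 1 - a^N as approximate indicators of a disk -/

namespace HyponormalOperator

noncomputable section

open ContinuousLinearMap Filter Topology

section BanachAlgebra

variable {𝔸 : Type*} [NormedRing 𝔸] [CompleteSpace 𝔸]

theorem tendsto_inverse_one_sub_pow_of_tendsto_zero {a : 𝔸}
    (ha : Tendsto (fun N : ℕ => a ^ N) atTop (𝓝 0)) :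
    (∀ᶠ N : ℕ in atTop, IsUnit (1 - a ^ N)) ∧
      Tendsto (fun N : ℕ => Ring.inverse (1 - a ^ N)) atTop (𝓝 1) := by
  have h1 : Tendsto (fun N : ℕ => 1 - a ^ N) atTop (𝓝 1) := by
    simpa using tendsto_const_nhds.sub ha
  refine ⟨h1.eventually (Units.isOpen.mem_nhds isUnit_one), ?_⟩
  have h2 := (NormedRing.inverse_continuousAt (1 : 𝔸ˣ)).tendsto
  rw [Units.val_one, Ring.inverse_one] at h2
  exact h2.comp h1

theorem tendsto_inverse_one_sub_pow_of_norm_lt_one {a : 𝔸} (ha : ‖a‖ < 1) :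
    (∀ᶠ N : ℕ in atTop, IsUnit (1 - a ^ N)) ∧
      Tendsto (fun N : ℕ => Ring.inverse (1 - a ^ N)) atTop (𝓝 1) :=
  tendsto_inverse_one_sub_pow_of_tendsto_zero (tendsto_pow_atTop_nhds_zero_of_norm_lt_one ha)

variable [NormedAlgebra ℂ 𝔸]

/-- By Gelfand's formula, ‖a^N‖ is eventually below s^N for any s strictly between the spectral
radius and 1. -/
theorem tendsto_pow_zero_of_spectralRadius_lt_one (a : 𝔸) (ha : spectralRadius ℂ a < 1) :
    Tendsto (fun N : ℕ => a ^ N) atTop (𝓝 0) := by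
  obtain ⟨s, hs, hs1⟩ := exists_between ha
  lift s to NNReal using (hs1.trans ENNReal.one_lt_top).ne
  have hev := (spectrum.pow_nnnorm_pow_one_div_tendsto_nhds_spectralRadius a).eventually_lt_const hs
  refine squeeze_zero_norm' (a := fun N => (s : ℝ) ^ N) ?_
    (tendsto_pow_atTop_nhds_zero_of_lt_one s.2 (by exact_mod_cast hs1))
  filter_upwards [hev, eventually_gt_atTop 0] with N hN hN0
  have h1 := ENNReal.rpow_le_rpow hN.le (Nat.cast_nonneg N : (0 : ℝ) ≤ N)
  rw [← ENNReal.rpow_mul, one_div, inv_mul_cancel₀ (by positivity), ENNReal.rpow_one,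
    ENNReal.rpow_natCast] at h1
  exact_mod_cast h1

/-- Here a is invertible and a⁻¹ has spectral radius below 1, since that radius is attained. The
factorisation 1 - a^N = -a^N (1 - a^{-N}) then gives an inverse of the form -(1 - a^{-N})⁻¹ a^{-N},
which tends to 0. -/
theorem tendsto_inverse_one_sub_pow_of_disjoint {a : 𝔸}
    (ha : Disjoint (spectrum ℂ a) (Metric.closedBall 0 1)) :
    (∀ᶠ N : ℕ in atTop, IsUnit (1 - a ^ N)) ∧
      Tendsto (fun N : ℕ => Ring.inverse (1 - a ^ N)) atTop (𝓝 0) := by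
  have h0 : IsUnit a := by
    by_contra h
    exact Set.disjoint_left.1 ha (spectrum.zero_mem ℂ h) (by simp)
  obtain ⟨u, rfl⟩ := h0
  have hpow : Tendsto (fun N : ℕ => (↑u⁻¹ : 𝔸) ^ N) atTop (𝓝 0) := by
    cases subsingleton_or_nontrivial 𝔸
    · simp [Subsingleton.elim _ (0 : 𝔸)]
    apply tendsto_pow_zero_of_spectralRadius_lt_one
    obtain ⟨z, hz, hzr⟩ := spectrum.exists_nnnorm_eq_spectralRadius (↑u⁻¹ : 𝔸)
    rw [← hzr]
    have hz0 : z⁻¹ ∈ spectrum ℂ (u : 𝔸) := by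
      rw [← spectrum.map_inv, Set.mem_inv] at hz
      exact hz
    have h1 : z⁻¹ ∉ Metric.closedBall (0 : ℂ) 1 := fun h => Set.disjoint_left.1 ha hz0 h
    rw [mem_closedBall_zero_iff, norm_inv, not_le] at h1
    have h2 : ‖z‖ < 1 := by
      by_contra! h
      exact absurd (inv_le_one_of_one_le₀ h) (not_le.2 h1)
    exact_mod_cast h2
  obtain ⟨h1, h2⟩ := tendsto_inverse_one_sub_pow_of_tendsto_zero hpow
  have hfac : ∀ N : ℕ, 1 - (u : 𝔸) ^ N = ↑(-(u ^ N)) * (1 - (↑u⁻¹ : 𝔸) ^ N) := fun N => by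
    rw [mul_sub, mul_one, Units.val_neg, neg_mul, ← Units.val_pow_eq_pow_val,
      ← Units.val_pow_eq_pow_val, inv_pow, Units.mul_inv]
    abel
  refine ⟨h1.mono fun N hN => ?_, ?_⟩
  · rw [hfac]
    exact (Units.isUnit _).mul hN
  · have h3 : Tendsto (fun N : ℕ => -(Ring.inverse (1 - (↑u⁻¹ : 𝔸) ^ N) * (↑u⁻¹ : 𝔸) ^ N))
        atTop (𝓝 0) := by
      simpa using (h2.mul hpow).neg
    refine h3.congr' (h1.mono fun N hN => ?_)
    obtain ⟨v, hv⟩ := hN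
    dsimp only
    rw [hfac, ← hv, ← Units.val_mul, Ring.inverse_unit, Ring.inverse_unit, mul_inv_rev]
    simp

end BanachAlgebra

/-! ### Direct sums and separation of the summands by polynomials -/

variable {H : Type*} [NormedAddCommGroup H] [InnerProductSpace ℂ H]
variable {κ : Type*}

/-- The orthogonal direct sum of a finite family of operators. -/
def directSum (A : κ → H →L[ℂ] H) :
    PiLp 2 (fun _ : κ => H) →L[ℂ] PiLp 2 (fun _ : κ => H) :=
  (PiLp.continuousLinearEquiv 2 ℂ (fun _ : κ => H)).symm.toContinuousLinearMap ∘L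
    ContinuousLinearMap.piMap A ∘L
      (PiLp.continuousLinearEquiv 2 ℂ (fun _ : κ => H)).toContinuousLinearMap

theorem directSum_apply (A : κ → H →L[ℂ] H) (v : PiLp 2 (fun _ : κ => H)) (i : κ) :
    directSum A v i = A i (v i) := rfl

variable [Fintype κ]

theorem aeval_directSum_apply (A : κ → H →L[ℂ] H) (p : Polynomial ℂ)
    (v : PiLp 2 (fun _ : κ => H)) (i : κ) :
    Polynomial.aeval (directSum A) p v i = Polynomial.aeval (A i) p (v i) := by
  have hpow : ∀ n : ℕ, (directSum A ^ n) v i = (A i ^ n) (v i) := fun n => by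
    induction n with
    | zero => simp
    | succ n ih =>
      rw [pow_succ', pow_succ']
      exact congrArg (A i) ih
  simp only [Polynomial.aeval_eq_sum_range, sum_apply, smul_apply, WithLp.ofLp_sum,
    Finset.sum_apply, WithLp.ofLp_smul, Pi.smul_apply, hpow]

theorem norm_directSum_le (A : κ → H →L[ℂ] H) {R : ℝ} (hR : 0 ≤ R) (hA : ∀ i, ‖A i‖ ≤ R) :
    ‖directSum A‖ ≤ R := by
  refine opNorm_le_bound _ hR fun v => ?_
  refine abs_le_of_sq_le_sq' ?_ (by positivity) |>.2
  rw [mul_pow, PiLp.norm_sq_eq_of_L2, PiLp.norm_sq_eq_of_L2, Finset.mul_sum]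
  refine Finset.sum_le_sum fun i _ => ?_
  rw [directSum_apply, ← mul_pow]
  gcongr
  exact (A i).le_of_opNorm_le (hA i) _

theorem isUnit_aeval_prod {ι : Type*} (s : Finset ι) (f : ι → Polynomial ℂ) (A : H →L[ℂ] H)
    (hf : ∀ j ∈ s, IsUnit (Polynomial.aeval A (f j))) :
    IsUnit (Polynomial.aeval A (∏ j ∈ s, f j)) := by
  classical
  induction s using Finset.induction_on with
  | empty => simp
  | insert j s hj ih =>
    rw [Finset.prod_insert hj, map_mul]
    exact (hf j (s.mem_insert_self j)).mul (ih fun k hk => hf k (Finset.mem_insert_of_mem hk))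

theorem disjoint_spectrum_smul_sub (A : H →L[ℂ] H) (a : ℂ) {ρ : ℝ} (hρ : 0 < ρ)
    (h : Disjoint (spectrum ℂ A) (Metric.closedBall a ρ)) :
    Disjoint (spectrum ℂ (((ρ⁻¹ : ℝ) : ℂ) • (A - algebraMap ℂ _ a))) (Metric.closedBall 0 1) := by
  have hρ' : ((ρ⁻¹ : ℝ) : ℂ) ≠ 0 := by simpa using hρ.ne'
  rw [Set.disjoint_left]
  intro z hz hz1
  have h1 := spectrum.smul_mem_smul_iff (R := ℂ) (s := z * ρ)
    (r := Units.mk0 _ hρ') (a := A - algebraMap ℂ _ a)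
  have h2 : (Units.mk0 _ hρ') • (z * (ρ : ℂ)) = z := by
    rw [Units.smul_def, smul_eq_mul, Units.val_mk0]
    push_cast
    field_simp [hρ.ne']
  rw [h2, Units.smul_def, Units.val_mk0] at h1
  have h3 := h1.1 hz
  rw [← spectrum.sub_singleton_eq, Set.sub_singleton] at h3
  obtain ⟨t, ht, htz⟩ := h3
  refine Set.disjoint_left.1 h ht ?_
  dsimp only at htz
  rw [mem_closedBall_iff_norm, htz, norm_mul, Complex.norm_real, Real.norm_of_nonneg hρ.le]
  rw [mem_closedBall_zero_iff] at hz1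
  nlinarith

variable [CompleteSpace H]

theorem adjoint_directSum (A : κ → H →L[ℂ] H) :
    adjoint (directSum A) = directSum fun i => adjoint (A i) := by
  symm
  rw [eq_adjoint_iff]
  intro v w
  simp [PiLp.inner_apply, directSum_apply, adjoint_inner_left]

theorem commForm_directSum (A : κ → H →L[ℂ] H) (v : PiLp 2 (fun _ : κ => H)) :
    commForm (directSum A) v = ∑ i, commForm (A i) (v i) := by
  simp only [commForm, adjoint_directSum, PiLp.norm_sq_eq_of_L2, directSum_apply,
    Finset.sum_sub_distrib]

/-- The trace inequality for a direct sum of hyponormal operators, all but one of which have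
spectra separated from the others by disks. -/
theorem sum_commForm_le_of_disjoint_disks {ι : Type*} [Fintype ι] (A : Option ι → H →L[ℂ] H)
    (hA : ∀ i x, 0 ≤ commForm (A i) x) {R : ℝ} (hR : 0 ≤ R) (hAR : ∀ i, ‖A i‖ ≤ R)
    (a : ι → ℂ) (ρ : ι → ℝ) (hρ : ∀ j, 0 < ρ j)
    (hin : ∀ j, ‖A (some j) - algebraMap ℂ _ (a j)‖ < ρ j)
    (hout : ∀ i j, i ≠ some j → Disjoint (spectrum ℂ (A i)) (Metric.closedBall (a j) (ρ j)))
    (x : Option ι → H) (hx : ∀ i, ‖x i‖ = 1) :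
    ∑ i, commForm (A i) (x i) ≤ R ^ 2 := by
  classical
  set e : Option ι → PiLp 2 (fun _ : Option ι => H) :=
    fun i => WithLp.toLp 2 (Pi.single i (x i)) with he
  have he_apply : ∀ i k, e i k = (Pi.single i (x i) : Option ι → H) k := fun i k => rfl
  have hon : Orthonormal ℂ e := by
    rw [orthonormal_iff_ite]
    intro i k
    rw [PiLp.inner_apply, Finset.sum_eq_single i]
    · by_cases hik : i = k
      · subst hik
        simp [he_apply, inner_self_eq_norm_sq_to_K, hx]
      · simp [he_apply, hik]
    · intro l _ hl
      simp [he_apply, Pi.single_eq_of_ne hl]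
    · simp
  have hform : ∀ i, commForm (directSum A) (e i) = commForm (A i) (x i) := fun i => by
    rw [commForm_directSum, Finset.sum_eq_single i]
    · simp [he_apply]
    · intro l _ hl
      simp [he_apply, Pi.single_eq_of_ne hl, commForm]
    · simp
  -- The inverse of 1 - ((z - a_j)/ρ_j)^N tends to 1 inside the j-th disk and to 0 outside it;
  -- evaluated on the summands, it isolates the j-th one.
  set b : ℕ → ι → Polynomial ℂ := fun N j =>
    1 - (Polynomial.C ((ρ j)⁻¹ : ℂ) * (Polynomial.X - Polynomial.C (a j))) ^ N with hb
  set B : Option ι → ι → (H →L[ℂ] H) := fun i j =>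
    (((ρ j)⁻¹ : ℝ) : ℂ) • (A i - algebraMap ℂ _ (a j)) with hB
  have hbB : ∀ N i j, Polynomial.aeval (A i) (b N j) = 1 - B i j ^ N := fun N i j => by
    simp [hb, hB, Algebra.smul_def]
  have hBij : ∀ i j, (∀ᶠ N : ℕ in atTop, IsUnit (1 - B i j ^ N)) ∧
      Tendsto (fun N : ℕ => Ring.inverse (1 - B i j ^ N)) atTop
        (𝓝 (if i = some j then 1 else 0)) := fun i j => by
    split_ifs with h
    · subst h
      apply tendsto_inverse_one_sub_pow_of_norm_lt_one
      rw [hB, norm_smul, Complex.norm_real, norm_inv, Real.norm_of_nonneg (hρ j).le,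
        inv_mul_lt_iff₀ (hρ j), mul_one]
      exact hin j
    · exact tendsto_inverse_one_sub_pow_of_disjoint
        (disjoint_spectrum_smul_sub _ _ (hρ j) (hout i j h))
  have hunit : ∀ᶠ N : ℕ in atTop, ∀ i j, IsUnit (1 - B i j ^ N) :=
    eventually_all.2 fun i => eventually_all.2 fun j => (hBij i j).1
  set q : ℕ → Polynomial ℂ := fun N => ∏ j, b N j with hq
  set r : ℕ → ι → Polynomial ℂ := fun N j => ∏ k ∈ Finset.univ.erase j, b N k with hr
  -- Dividing by the common denominator q lets polynomials do the work of rational functions: since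
  -- r_j = q / b_j, the vector r_j(A) y is b_j(A)⁻¹ applied to all the x i at once.
  set y : ℕ → PiLp 2 (fun _ : Option ι => H) := fun N =>
    WithLp.toLp 2 fun i => Ring.inverse (Polynomial.aeval (A i) (q N)) (x i) with hy
  have hy_apply : ∀ N i, y N i = Ring.inverse (Polynomial.aeval (A i) (q N)) (x i) :=
    fun N i => rfl
  have hqu : ∀ᶠ N : ℕ in atTop, ∀ i, IsUnit (Polynomial.aeval (A i) (q N)) :=
    hunit.mono fun N hN i => isUnit_aeval_prod _ _ _ fun j _ => by
      rw [hbB]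
      exact hN i j
  have hry : ∀ᶠ N : ℕ in atTop, ∀ i j,
      Polynomial.aeval (A i) (r N j) (y N i) = Ring.inverse (1 - B i j ^ N) (x i) := by
    filter_upwards [hunit, hqu] with N hN hqN i j
    have h1 : Polynomial.aeval (A i) (q N)
        = (1 - B i j ^ N) * Polynomial.aeval (A i) (r N j) := by
      rw [← hbB, ← map_mul, hq, hr]
      congr 1
      exact (Finset.mul_prod_erase _ _ (Finset.mem_univ j)).symm
    have h2 : Polynomial.aeval (A i) (r N j) * Ring.inverse (Polynomial.aeval (A i) (q N))
        = Ring.inverse (1 - B i j ^ N) := by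
      rw [← Ring.inverse_mul_cancel_left _ (Polynomial.aeval (A i) (r N j) * _) (hN i j),
        ← mul_assoc (1 - B i j ^ N), ← h1, Ring.mul_inverse_cancel _ (hqN i), mul_one]
    rw [hy_apply, ← h2]
    rfl
  have hsome : ∀ i j, Tendsto (fun N => Polynomial.aeval (A i) (r N j) (y N i)) atTop
      (𝓝 (e (some j) i)) := fun i j => by
    have h1 : Tendsto (fun N : ℕ => (Ring.inverse (1 - B i j ^ N) : H →L[ℂ] H) (x i)) atTop
        (𝓝 (e (some j) i)) := by
      have h2 := ((ContinuousLinearMap.apply ℂ H (x i)).continuous.tendsto _).comp (hBij i j).2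
      refine (h2.congr fun _ => rfl).trans_eq ?_ |> fun h => h
      congr 1
      by_cases h : i = some j
      · subst h
        simp [he_apply]
      · simp [he_apply, h]
    exact h1.congr' (hry.mono fun N hN => (hN i j).symm)
  -- As q(A) y is the full vector of the x i, subtracting the parts isolated by the r_j leaves the
  -- distinguished summand `none`.
  set p : ℕ → Option ι → Polynomial ℂ := fun N i =>
    i.elim (q N - ∑ j, r N j) (fun j => r N j) with hp
  have hlim : ∀ k, Tendsto (fun N => Polynomial.aeval (directSum A) (p N k) (y N)) atTop
      (𝓝 (e k)) := fun k => by
    have h1 : Tendsto (fun N i => Polynomial.aeval (directSum A) (p N k) (y N) i) atTop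
        (𝓝 (fun i => e k i)) := by
      rw [tendsto_pi_nhds]
      intro i
      simp_rw [aeval_directSum_apply]
      cases k with
      | some j => exact hsome i j
      | none =>
        have h2 : Tendsto (fun N => x i - ∑ j, Polynomial.aeval (A i) (r N j) (y N i)) atTop
            (𝓝 (x i - ∑ j, e (some j) i)) :=
          tendsto_const_nhds.sub (tendsto_finsetSum _ fun j _ => hsome i j)
        have h3 : x i - ∑ j, e (some j) i = e none i := by
          cases i with
          | none => simp [he_apply]
          | some l => simp [he_apply, Pi.single_apply]
        rw [h3] at h2
        refine h2.congr' (hqu.mono fun N hN => ?_)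
        simp only [hp, Option.elim, map_sub, map_sum, sub_apply, sum_apply]
        rw [hy_apply]
        refine congrArg (· - _) ?_
        exact (congrArg (fun D : H →L[ℂ] H => D (x i)) (Ring.mul_inverse_cancel _ (hN i))).symm
    exact ((PiLp.continuous_toLp 2 (fun _ : Option ι => H)).tendsto _).comp h1
  have hfinal := sum_commForm_le_of_approx (directSum A)
    (fun v => by
      rw [commForm_directSum]
      exact Finset.sum_nonneg fun i _ => hA i _) e hon y p hlim
  simp_rw [hform] at hfinal
  exact hfinal.trans (by
    gcongr
    exact norm_directSum_le A hR hAR)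

end

end HyponormalOperator

/-! ### Putnam's inequality -/

namespace HyponormalOperator

noncomputable section

open ContinuousLinearMap Filter Topology

variable {H : Type*} [NormedAddCommGroup H] [InnerProductSpace ℂ H]

theorem norm_le_one_of_isometry {S : H →L[ℂ] H} (hS : ∀ v, ‖S v‖ = ‖v‖) : ‖S‖ ≤ 1 :=
  opNorm_le_bound _ zero_le_one fun v => by rw [hS, one_mul]

variable [CompleteSpace H]

/-- Translation by a scalar does not change the self-commutator and dilation by c scales it by |c|²,
so an isometry placed on a disk of radius r contributes r² at a unit vector killed by its adjoint.
-/
theorem commForm_algebraMap_add_smul (S : H →L[ℂ] H) (a c : ℂ) (v : H) :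
    commForm (algebraMap ℂ _ a + c • S) v = ‖c‖ ^ 2 * commForm S v := by
  have h1 : (algebraMap ℂ (H →L[ℂ] H) a + c • S) v = a • v + c • S v := by
    simp [Algebra.algebraMap_eq_smul_one]
  have h2 : adjoint (algebraMap ℂ (H →L[ℂ] H) a + c • S) v
      = (starRingEnd ℂ) a • v + (starRingEnd ℂ) c • adjoint S v := by
    refine ext_inner_right ℂ fun u => ?_
    rw [adjoint_inner_left]
    simp [Algebra.algebraMap_eq_smul_one, inner_add_left, inner_add_right, inner_smul_left,
      inner_smul_right, adjoint_inner_left]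
  have h3 : RCLike.re (inner ℂ ((starRingEnd ℂ) a • v) ((starRingEnd ℂ) c • adjoint S v))
      = RCLike.re (inner ℂ (a • v) (c • S v)) := by
    rw [← RCLike.conj_re, inner_conj_symm, inner_smul_left, inner_smul_right, inner_smul_left,
      inner_smul_right, adjoint_inner_left, RCLike.conj_conj]
    ring_nf
  rw [commForm, h1, h2, norm_add_sq (𝕜 := ℂ), norm_add_sq (𝕜 := ℂ), h3, commForm]
  simp only [norm_smul, RCLike.norm_conj]
  ring

theorem commForm_nonneg_of_isometry {S : H →L[ℂ] H} (hS : ∀ v, ‖S v‖ = ‖v‖) (v : H) :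
    0 ≤ commForm S v := by
  have h1 : ‖adjoint S v‖ ≤ 1 * ‖v‖ :=
    le_of_opNorm_le _ (by rw [LinearIsometryEquiv.norm_map]; exact norm_le_one_of_isometry hS) v
  rw [commForm, hS, sub_nonneg]
  gcongr
  linarith

/-- Filling up the complement of the spectrum by disks. -/
theorem commForm_add_sum_sq_le (T : H →L[ℂ] H) (hT : ∀ x, 0 ≤ commForm T x)
    (S : H →L[ℂ] H) (hS : ∀ v, ‖S v‖ = ‖v‖) (e : H) (he : ‖e‖ = 1) (hSe : adjoint S e = 0)
    (x : H) (hx : ‖x‖ = 1) (s : Finset ℂ) (r : ℂ → ℝ) (hr : ∀ a ∈ s, 0 < r a)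
    (hrR : ∀ a ∈ s, ‖a‖ + r a ≤ ‖T‖)
    (hrT : ∀ a ∈ s, Disjoint (spectrum ℂ T) (Metric.closedBall a (r a)))
    (hdisj : (s : Set ℂ).PairwiseDisjoint fun a => Metric.closedBall a (r a)) :
    commForm T x + ∑ a ∈ s, r a ^ 2 ≤ ‖T‖ ^ 2 := by
  have : Nontrivial H := ⟨e, 0, by rintro rfl; simp at he⟩
  have hSn := norm_le_one_of_isometry hS
  have hform : commForm S e = 1 := by simp [commForm, hS, he, hSe]
  -- Shrinking by τ < 1 gives the strict norm bound that the separation of summands needs; τ → 1 at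
  -- the end.
  have key : ∀ τ : ℝ, 0 < τ → τ < 1 →
      commForm T x + ∑ a ∈ s, (τ * r a) ^ 2 ≤ ‖T‖ ^ 2 := fun τ hτ hτ1 => by
    set A : Option s → H →L[ℂ] H := fun i =>
      i.elim T fun j => algebraMap ℂ _ (j : ℂ) + ((τ * r j : ℝ) : ℂ) • S with hA
    have hn : ∀ j : s, ‖((τ * r j : ℝ) : ℂ) • S‖ < r j := fun j => by
      have h0 := hr j j.2
      rw [norm_smul, Complex.norm_real, Real.norm_of_nonneg (by positivity)]
      calc τ * r j * ‖S‖ ≤ τ * r j * 1 := by gcongr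
        _ < r j := by nlinarith
    have hspec : ∀ j : s, spectrum ℂ (A (some j)) ⊆ Metric.closedBall (j : ℂ) (r j) :=
      fun j z hz => by
        have h1 : A (some j) = algebraMap ℂ _ (j : ℂ) + ((τ * r j : ℝ) : ℂ) • S := rfl
        rw [h1, ← spectrum.singleton_add_eq, Set.singleton_add] at hz
        obtain ⟨u, hu, rfl⟩ := hz
        have := spectrum.norm_le_norm_of_mem hu
        simpa using this.trans (hn j).le
    have h := sum_commForm_le_of_disjoint_disks A (R := ‖T‖) (fun i v => ?_) (norm_nonneg _)
      (fun i => ?_) (fun j : s => (j : ℂ)) (fun j => r j) (fun j => hr j j.2) (fun j => ?_)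
      (fun i j hij => ?_) (fun i => i.elim x fun _ => e) (fun i => ?_)
    · rw [Fintype.sum_option] at h
      have h2 : ∀ j : s, commForm (A (some j)) e = (τ * r j) ^ 2 := fun j => by
        have h1 : A (some j) = algebraMap ℂ _ (j : ℂ) + ((τ * r j : ℝ) : ℂ) • S := rfl
        rw [h1, commForm_algebraMap_add_smul, hform, Complex.norm_real, mul_one, Real.norm_eq_abs,
          sq_abs]
      simp only [Option.elim] at h
      simp_rw [h2] at h
      rwa [← Finset.sum_coe_sort]
    · cases i with
      | none => exact hT v
      | some j =>
        change 0 ≤ commForm (algebraMap ℂ _ (j : ℂ) + ((τ * r j : ℝ) : ℂ) • S) v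
        rw [commForm_algebraMap_add_smul]
        exact mul_nonneg (sq_nonneg _) (commForm_nonneg_of_isometry hS v)
    · cases i with
      | none => exact le_rfl
      | some j =>
        refine (norm_add_le _ _).trans ((add_le_add ?_ (hn j).le).trans (hrR j j.2))
        rw [norm_algebraMap']
    · simpa [hA] using hn j
    · cases i with
      | none => exact hrT j j.2
      | some k =>
        have hkj : (k : ℂ) ≠ j := fun h => hij (by rw [Subtype.ext h])
        exact (hdisj k.2 j.2 hkj).mono_left (hspec k)
    · cases i with
      | none => exact hx
      | some j => exact he
  have hlim : Tendsto (fun τ : ℝ => commForm T x + ∑ a ∈ s, (τ * r a) ^ 2) (𝓝[<] 1)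
      (𝓝 (commForm T x + ∑ a ∈ s, (1 * r a) ^ 2)) :=
    ((by fun_prop : Continuous fun τ : ℝ => commForm T x + ∑ a ∈ s, (τ * r a) ^ 2).tendsto
      1).mono_left nhdsWithin_le_nhds
  simp only [one_mul] at hlim
  refine le_of_tendsto hlim ?_
  filter_upwards [Ioo_mem_nhdsLT zero_lt_one] with τ hτ using key τ hτ.1 hτ.2

/-- **Putnam's inequality**: the self-commutator of a hyponormal operator has norm at most
`Area(sp T) / π`. The space is assumed to carry a non-unitary isometry. -/
theorem putnam_inequality (T : H →L[ℂ] H) (hT : ∀ x, 0 ≤ commForm T x)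
    (S : H →L[ℂ] H) (hS : ∀ v, ‖S v‖ = ‖v‖) (e : H) (he : ‖e‖ = 1) (hSe : adjoint S e = 0)
    (x : H) (hx : ‖x‖ = 1) :
    ENNReal.ofReal (Real.pi * commForm T x) ≤ volume (spectrum ℂ T) := by
  have : Nontrivial H := ⟨e, 0, by rintro rfl; simp at he⟩
  have hpi := Real.pi_pos
  set K := spectrum ℂ T with hK
  have hKc : IsClosed K := spectrum.isClosed T
  set U : Set ℂ := Metric.ball 0 ‖T‖ \ K with hU
  -- Admissible disks lie in the disk of radius ‖T‖, so that the direct sum has norm at most ‖T‖,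
  -- and miss the spectrum. Arbitrarily small ones exist at every point of the open set U.
  obtain ⟨t, r, htc, htU, htr, hcov, hdisj⟩ :=
    Besicovitch.exists_disjoint_closedBall_covering_ae (volume : Measure ℂ)
      (fun a => {ρ | ‖a‖ + ρ ≤ ‖T‖ ∧ Disjoint K (Metric.closedBall a ρ)}) U
      (fun a ha δ hδ => by
        have h1 : ‖a‖ < ‖T‖ := mem_ball_zero_iff.1 ha.1
        obtain ⟨ε, hε, hεK⟩ := Metric.isOpen_iff.1 hKc.isOpen_compl a ha.2
        refine ⟨min (min (ε / 2) (δ / 2)) (‖T‖ - ‖a‖), ⟨?_, ?_⟩, ?_, ?_⟩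
        · linarith [min_le_right (min (ε / 2) (δ / 2)) (‖T‖ - ‖a‖)]
        · refine Set.disjoint_left.2 fun z hzK hz => hεK ?_ hzK
          rw [Metric.mem_closedBall] at hz
          rw [Metric.mem_ball]
          linarith [min_le_left (min (ε / 2) (δ / 2)) (‖T‖ - ‖a‖), min_le_left (ε / 2) (δ / 2)]
        · have : 0 < ‖T‖ - ‖a‖ := by linarith
          positivity
        · linarith [min_le_left (min (ε / 2) (δ / 2)) (‖T‖ - ‖a‖), min_le_right (ε / 2) (δ / 2)])
      (fun _ => 1) (fun _ _ => one_pos)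
  have : Countable t := htc.to_subtype
  have hball : ∀ a ∈ t, volume (Metric.closedBall a (r a)) = ENNReal.ofReal (Real.pi * r a ^ 2) :=
    fun a ha => by
      rw [Complex.volume_closedBall, mul_comm, ENNReal.ofReal_mul hpi.le,
        ENNReal.ofReal_pow (htr a ha).2.1.le, ← NNReal.coe_real_pi, ENNReal.ofReal_coe_nnreal]
  have hupper : ENNReal.ofReal (Real.pi * commForm T x)
      + ∑' a : t, volume (Metric.closedBall (a : ℂ) (r a))
        ≤ ENNReal.ofReal (Real.pi * ‖T‖ ^ 2) := by
    rw [ENNReal.tsum_eq_iSup_sum, ENNReal.add_iSup]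
    refine iSup_le fun s => ?_
    have h1 := commForm_add_sum_sq_le T hT S hS e he hSe x hx (s.map (Function.Embedding.subtype _))
      r (fun a ha => ?_) (fun a ha => ?_) (fun a ha => ?_) (fun a ha b hb hab => ?_)
    · rw [Finset.sum_map] at h1
      rw [Finset.sum_congr rfl fun (a : t) _ => hball a a.2, ← ENNReal.ofReal_sum_of_nonneg
        (fun a _ => by positivity), ← ENNReal.ofReal_add (mul_nonneg hpi.le (hT x))
        (Finset.sum_nonneg fun a _ => by positivity), ← Finset.mul_sum, ← mul_add]
      exact ENNReal.ofReal_le_ofReal (mul_le_mul_of_nonneg_left h1 hpi.le)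
    all_goals
      obtain ⟨a, _, rfl⟩ := Finset.mem_map.1 ha
    · exact (htr a a.2).2.1
    · exact (htr a a.2).1.1
    · exact (htr a a.2).1.2
    · obtain ⟨b, _, rfl⟩ := Finset.mem_map.1 hb
      exact hdisj a.2 b.2 hab
  have hlower : ENNReal.ofReal (Real.pi * ‖T‖ ^ 2)
      ≤ volume K + ∑' a : t, volume (Metric.closedBall (a : ℂ) (r a)) := by
    calc ENNReal.ofReal (Real.pi * ‖T‖ ^ 2) = volume (Metric.ball (0 : ℂ) ‖T‖) := by
          rw [Complex.volume_ball, mul_comm, ENNReal.ofReal_mul' hpi.le,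
            ENNReal.ofReal_pow (norm_nonneg _), ← NNReal.coe_real_pi, ENNReal.ofReal_coe_nnreal]
      _ ≤ volume (K ∪ ((U \ ⋃ a ∈ t, Metric.closedBall a (r a))
            ∪ ⋃ a ∈ t, Metric.closedBall a (r a))) := by
          refine measure_mono fun z hz => ?_
          by_cases hzK : z ∈ K
          · exact Or.inl hzK
          · rw [Set.sdiff_union_self]
            exact Or.inr (Or.inl ⟨hz, hzK⟩)
      _ ≤ volume K + (volume (U \ ⋃ a ∈ t, Metric.closedBall a (r a))
            + volume (⋃ a ∈ t, Metric.closedBall a (r a))) :=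
          (measure_union_le _ _).trans (add_le_add_right (measure_union_le _ _) _)
      _ ≤ volume K + ∑' a : t, volume (Metric.closedBall (a : ℂ) (r a)) := by
          rw [hcov, zero_add]
          exact add_le_add_right (measure_biUnion_le _ htc _) _
  -- Finiteness of the total disk area is what allows it to be cancelled from both bounds.
  have hfin : ∑' a : t, volume (Metric.closedBall (a : ℂ) (r a)) ≠ ⊤ :=
    ((le_add_self.trans hupper).trans_lt ENNReal.ofReal_lt_top).ne
  exact (ENNReal.add_le_add_iff_right hfin).1 (hupper.trans hlower)

end

end HyponormalOperator

/-! ### Fourier monomials, multiplication operators and Toeplitz adjoints -/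

namespace HardyToeplitz

noncomputable section

open ContinuousLinearMap HyponormalOperator

/-- The monomial `e^{inθ}` in `L²`. -/
def mono2 (n : ℤ) : L2 := fourierLp 2 n

/-- The monomial `e^{inθ}` in `L^∞`. -/
def monoInf (n : ℤ) : Linf := fourierLp ∞ n

theorem coeFn_mono2 (n : ℤ) : (mono2 n : UCircle → ℂ) =ᵐ[arc] fourier n := coeFn_fourierLp 2 n

theorem coeFn_monoInf (n : ℤ) : (monoInf n : UCircle → ℂ) =ᵐ[arc] fourier n := coeFn_fourierLp ∞ n

theorem fourierBasis_eq_mono2 (n : ℤ) : fourierBasis n = mono2 n := by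
  rw [coe_fourierBasis]
  rfl

theorem inner_mono2 (n : ℤ) (v : L2) : inner ℂ (mono2 n) v = fourierCoeff (v : UCircle → ℂ) n := by
  rw [← fourierBasis_repr, HilbertBasis.repr_apply_apply, fourierBasis_eq_mono2]

theorem orthonormal_mono2 : Orthonormal ℂ mono2 := orthonormal_fourier

theorem norm_mono2 (n : ℤ) : ‖mono2 n‖ = 1 := orthonormal_mono2.1 n

theorem mem_H2_iff_inner {v : L2} : v ∈ H2 ↔ ∀ n : ℤ, n < 0 → inner ℂ (mono2 n) v = 0 := by
  simp_rw [inner_mono2]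
  rfl

theorem mono2_mem_H2 {n : ℤ} (hn : 0 ≤ n) : mono2 n ∈ H2 :=
  mem_H2_iff_inner.2 fun _ hk => orthonormal_mono2.2 (by omega)

theorem hasSum_inner_mono2 (v w : L2) :
    HasSum (fun n : ℤ => inner ℂ v (mono2 n) * inner ℂ (mono2 n) w) (inner ℂ v w) := by
  simpa only [fourierBasis_eq_mono2] using
    (fourierBasis (T := 2 * Real.pi)).hasSum_inner_mul_inner v w

theorem mem_H2_orthogonal_iff_inner {v : L2} :
    v ∈ H2ᗮ ↔ ∀ n : ℤ, 0 ≤ n → inner ℂ (mono2 n) v = 0 := by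
  rw [Submodule.mem_orthogonal]
  refine ⟨fun h n hn => h _ (mono2_mem_H2 hn), fun h q hq => ?_⟩
  refine (hasSum_inner_mono2 q v).unique ?_
  convert! hasSum_zero with n
  rcases lt_or_ge n 0 with hn | hn
  · rw [← inner_conj_symm, mem_H2_iff_inner.1 hq n hn, map_zero, zero_mul]
  · rw [h n hn, mul_zero]

theorem mono2_mem_H2_orthogonal {n : ℤ} (hn : n < 0) : mono2 n ∈ H2ᗮ :=
  mem_H2_orthogonal_iff_inner.2 fun _ hk => orthonormal_mono2.2 (by omega)

theorem coeFn_smul_L2 (φ : Linf) (v : L2) :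
    ((φ • v : L2) : UCircle → ℂ) =ᵐ[arc] fun t => φ t * v t := Lp.coeFn_lpSMul φ v

theorem coeFn_smul_Linf (φ ψ : Linf) :
    ((φ • ψ : Linf) : UCircle → ℂ) =ᵐ[arc] fun t => φ t * ψ t := Lp.coeFn_lpSMul φ ψ

theorem coeFn_star_Lp {p : ℝ≥0∞} (v : Lp ℂ p arc) :
    ((star v : Lp ℂ p arc) : UCircle → ℂ) =ᵐ[arc] fun t => star (v t) :=
  Lp.coeFn_star v

theorem toL2_add (φ ψ : Linf) : toL2 (φ + ψ) = toL2 φ + toL2 ψ := by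
  ext1
  filter_upwards [coeFn_toL2 (φ + ψ), coeFn_toL2 φ, coeFn_toL2 ψ, Lp.coeFn_add φ ψ,
    Lp.coeFn_add (toL2 φ) (toL2 ψ)] with t h1 h2 h3 h4 h5
  rw [h1, h4, h5, Pi.add_apply, Pi.add_apply, h2, h3]

theorem toL2_star (φ : Linf) : toL2 (star φ) = star (toL2 φ) := by
  ext1
  filter_upwards [coeFn_toL2 (star φ), coeFn_toL2 φ, coeFn_star_Lp φ, coeFn_star_Lp (toL2 φ)]
    with t h1 h2 h3 h4
  rw [h1, h3, h4, h2]

theorem toL2_smul (φ ψ : Linf) : toL2 (φ • ψ : Linf) = φ • toL2 ψ := by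
  ext1
  filter_upwards [coeFn_toL2 (φ • ψ : Linf), coeFn_toL2 ψ, coeFn_smul_Linf φ ψ,
    coeFn_smul_L2 φ (toL2 ψ)] with t h1 h2 h3 h4
  rw [h1, h3, h4, h2]

theorem star_add_Lp {p : ℝ≥0∞} (v w : Lp ℂ p arc) : star (v + w) = star v + star w := by
  ext1
  filter_upwards [coeFn_star_Lp (v + w), coeFn_star_Lp v, coeFn_star_Lp w, Lp.coeFn_add v w,
    Lp.coeFn_add (star v) (star w)] with t h1 h2 h3 h4 h5
  rw [h1, h4, h5, Pi.add_apply, Pi.add_apply, h2, h3, star_add]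

theorem star_smul_L2 (φ : Linf) (v : L2) : star (φ • v : L2) = star φ • star v := by
  ext1
  filter_upwards [coeFn_star_Lp (φ • v : L2), coeFn_star_Lp φ, coeFn_star_Lp v, coeFn_smul_L2 φ v,
    coeFn_smul_L2 (star φ) (star v)] with t h1 h2 h3 h4 h5
  rw [h1, h4, h5, h2, h3, star_mul']

theorem smul_left_comm_L2 (φ ψ : Linf) (v : L2) : (φ • (ψ • v : L2) : L2) = ψ • (φ • v : L2) := by
  ext1
  filter_upwards [coeFn_smul_L2 φ (ψ • v : L2), coeFn_smul_L2 ψ v, coeFn_smul_L2 ψ (φ • v : L2),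
    coeFn_smul_L2 φ v] with t h1 h2 h3 h4
  rw [h1, h2, h3, h4, mul_left_comm]

theorem smul_assoc_L2 (φ ψ : Linf) (v : L2) : ((φ • ψ : Linf) • v : L2) = φ • (ψ • v : L2) := by
  ext1
  filter_upwards [coeFn_smul_L2 (φ • ψ : Linf) v, coeFn_smul_L2 ψ v, coeFn_smul_L2 φ (ψ • v : L2),
    coeFn_smul_Linf φ ψ] with t h1 h2 h3 h4
  rw [h1, h3, h2, h4, mul_assoc]

theorem inner_star_mul (v w : L2) :
    inner ℂ v w = ∫ t, w t * star (v t) ∂arc := by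
  rw [L2.inner_def]
  rfl

theorem inner_smul_left_L2 (φ : Linf) (v w : L2) :
    inner ℂ (φ • v : L2) w = inner ℂ v (star φ • w : L2) := by
  rw [inner_star_mul, inner_star_mul]
  refine integral_congr_ae ?_
  filter_upwards [coeFn_smul_L2 φ v, coeFn_smul_L2 (star φ) w, coeFn_star_Lp φ] with t h1 h2 h3
  rw [h1, h2, h3, star_mul']
  ring

theorem inner_star_L2 (v w : L2) : inner ℂ (star v) (star w) = inner ℂ w v := by
  rw [inner_star_mul, inner_star_mul]
  refine integral_congr_ae ?_
  filter_upwards [coeFn_star_Lp v, coeFn_star_Lp w] with t h1 h2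
  rw [h1, h2, star_star, mul_comm]

theorem star_mono2 (n : ℤ) : star (mono2 n) = mono2 (-n) := by
  ext1
  filter_upwards [coeFn_star_Lp (mono2 n), coeFn_mono2 n, coeFn_mono2 (-n)] with t h1 h2 h3
  rw [h1, h2, h3, fourier_neg]
  rfl

theorem star_monoInf (n : ℤ) : star (monoInf n) = monoInf (-n) := by
  ext1
  filter_upwards [coeFn_star_Lp (monoInf n), coeFn_monoInf n, coeFn_monoInf (-n)] with t h1 h2 h3
  rw [h1, h2, h3, fourier_neg]
  rfl

theorem monoInf_smul_mono2 (m n : ℤ) : (monoInf m • mono2 n : L2) = mono2 (m + n) := by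
  ext1
  filter_upwards [coeFn_smul_L2 (monoInf m) (mono2 n), coeFn_monoInf m, coeFn_mono2 n,
    coeFn_mono2 (m + n)] with t h1 h2 h3 h4
  rw [h1, h2, h3, h4, fourier_add]

theorem smul_mono2 (φ : Linf) (n : ℤ) : (φ • mono2 n : L2) = monoInf n • toL2 φ := by
  ext1
  filter_upwards [coeFn_smul_L2 φ (mono2 n), coeFn_monoInf n, coeFn_mono2 n,
    coeFn_smul_L2 (monoInf n) (toL2 φ), coeFn_toL2 φ] with t h1 h2 h3 h4 h5
  rw [h1, h3, h4, h2, h5, mul_comm]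

theorem inner_mono2_monoInf_smul (m n : ℤ) (v : L2) :
    inner ℂ (mono2 m) (monoInf n • v : L2) = inner ℂ (mono2 (m - n)) v := by
  rw [← star_star (monoInf n), ← inner_smul_left_L2, star_monoInf, monoInf_smul_mono2]
  congr 2
  ring

theorem norm_star_smul_L2 (φ : Linf) (v : L2) : ‖(star φ • v : L2)‖ = ‖(φ • v : L2)‖ := by
  have h : inner ℂ (star φ • v : L2) (star φ • v : L2) = inner ℂ (φ • v : L2) (φ • v : L2) := by
    rw [inner_smul_left_L2, inner_smul_left_L2, star_star, smul_left_comm_L2]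
  rw [inner_self_eq_norm_sq_to_K, inner_self_eq_norm_sq_to_K] at h
  have h' : ‖(star φ • v : L2)‖ ^ 2 = ‖(φ • v : L2)‖ ^ 2 := by exact_mod_cast h
  exact (pow_left_inj₀ (norm_nonneg _) (norm_nonneg _) two_ne_zero).1 h'

theorem norm_monoInf_smul (n : ℤ) (v : L2) : ‖(monoInf n • v : L2)‖ = ‖v‖ := by
  have h : inner ℂ (monoInf n • v : L2) (monoInf n • v : L2) = inner ℂ v v := by
    rw [inner_smul_left_L2, star_monoInf]
    congr 1
    ext1
    filter_upwards [coeFn_smul_L2 (monoInf (-n)) (monoInf n • v : L2), coeFn_monoInf n,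
      coeFn_monoInf (-n), coeFn_smul_L2 (monoInf n) v] with t h1 h2 h3 h4
    rw [h1, h4, h2, h3, ← mul_assoc, ← fourier_add, neg_add_cancel, fourier_zero, one_mul]
  rw [inner_self_eq_norm_sq_to_K, inner_self_eq_norm_sq_to_K] at h
  have h' : ‖(monoInf n • v : L2)‖ ^ 2 = ‖v‖ ^ 2 := by exact_mod_cast h
  exact (pow_left_inj₀ (norm_nonneg _) (norm_nonneg _) two_ne_zero).1 h'

/-- `H^∞ · H² ⊆ H²`. -/
theorem smul_mem_H2 {φ : Linf} (hφ : φ ∈ Hinf) {p : L2} (hp : p ∈ H2) : (φ • p : L2) ∈ H2 := by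
  refine mem_H2_iff_inner.2 fun n hn => ?_
  rw [← star_star φ, ← inner_smul_left_L2]
  refine (hasSum_inner_mono2 _ p).unique ?_
  convert! hasSum_zero with k
  rcases lt_or_ge k 0 with hk | hk
  · rw [mem_H2_iff_inner.1 hp k hk, mul_zero]
  · rw [inner_smul_left_L2, star_star, smul_mono2, inner_mono2_monoInf_smul,
      mem_H2_iff_inner.1 hφ _ (by omega), zero_mul]

theorem poissonExt_zero (φ : Linf) : poissonExt φ 0 = inner ℂ (mono2 0) (toL2 φ) := by
  rw [inner_mono2, poissonExt, fourierCoeff]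
  refine integral_congr_ae ?_
  filter_upwards [coeFn_toL2 φ] with t h1
  simp [poissonKernel, h1]

theorem const_eq_smul_mono2 (c : ℂ) : Lp.const 2 arc c = c • mono2 0 := by
  ext1
  filter_upwards [Lp.coeFn_const 2 arc c, Lp.coeFn_smul c (mono2 0), coeFn_mono2 0]
    with t h1 h2 h3
  rw [h1, h2, Pi.smul_apply, h3, fourier_zero]
  simp

theorem adjoint_toeplitz (φ : Linf) : adjoint (toeplitz φ) = toeplitz (star φ) := by
  symm
  rw [eq_adjoint_iff]
  intro p q
  rw [toeplitz_apply, toeplitz_apply, rieszProj,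
    Submodule.inner_orthogonalProjectionOnto_eq_of_mem_right,
    Submodule.inner_orthogonalProjectionOnto_eq_of_mem_left, inner_smul_left_L2, star_star]

/-- Since φ p and φ̄ p have equal norms, Pythagoras turns the difference of their H² parts into the
opposite difference of their parts in (H²)ᗮ. -/
theorem commForm_toeplitz (φ : Linf) (p : H2) :
    commForm (toeplitz φ) p
      = ‖H2ᗮ.starProjection (star φ • (p : L2))‖ ^ 2 - ‖H2ᗮ.starProjection (φ • (p : L2))‖ ^ 2 := by
  have h1 := H2.norm_sq_eq_add_norm_sq_starProjection (φ • (p : L2) : L2)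
  have h2 := H2.norm_sq_eq_add_norm_sq_starProjection (star φ • (p : L2) : L2)
  rw [norm_star_smul_L2] at h2
  have h3 : ∀ ψ : Linf, ‖toeplitz ψ p‖ = ‖H2.starProjection (ψ • (p : L2))‖ := fun ψ => rfl
  rw [commForm, adjoint_toeplitz, h3, h3]
  linarith

end

end HardyToeplitz

/-! ### The rank-one lower bound for the self-commutator -/

namespace HardyToeplitz

noncomputable section

open ContinuousLinearMap HyponormalOperator

theorem add_smul_L2 (φ ψ : Linf) (v : L2) : ((φ + ψ) • v : L2) = φ • v + ψ • v :=
  Lp.smul_add φ ψ v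

theorem smul_add_L2 (φ : Linf) (v w : L2) : (φ • (v + w) : L2) = φ • v + φ • w :=
  Lp.add_smul φ v w

theorem smul_smul_L2 (φ : Linf) (c : ℂ) (v : L2) : (φ • (c • v) : L2) = c • (φ • v : L2) :=
  ((ContinuousLinearMap.mul ℂ ℂ).holderL arc ∞ 2 2 φ).map_smul c v

theorem starProjection_orthogonal_eq_zero {v : L2} (hv : v ∈ H2) : H2ᗮ.starProjection v = 0 :=
  (Submodule.starProjection_apply_eq_zero_iff _).2 (H2.le_orthogonal_orthogonal hv)

theorem norm_starProjection_smul_le {h : Linf} (hn : ‖h‖ ≤ 1) (v : L2) :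
    ‖H2ᗮ.starProjection (h • v : L2)‖ ≤ ‖v‖ :=
  calc ‖H2ᗮ.starProjection (h • v : L2)‖ ≤ ‖(h • v : L2)‖ := H2ᗮ.norm_starProjection_apply_le _
    _ ≤ ‖h‖ * ‖v‖ := Lp.norm_smul_le h v
    _ ≤ 1 * ‖v‖ := by gcongr
    _ = ‖v‖ := one_mul _

/-- A multiplication by `h ∈ H^∞` with `‖h‖ ≤ 1`, `h(0) = 0`, compressed to `(H²)ᗮ`, annihilates
`e^{-iθ}`. -/
theorem norm_sq_starProjection_smul_le {h : Linf} (hh : h ∈ Hinf) (hn : ‖h‖ ≤ 1)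
    (h0 : inner ℂ (mono2 0) (toL2 h) = 0) (u : L2) :
    ‖H2ᗮ.starProjection (h • u : L2)‖ ^ 2 ≤ ‖u‖ ^ 2 - ‖inner ℂ (mono2 (-1)) u‖ ^ 2 := by
  set c := inner ℂ (mono2 (-1)) u with hc
  set u' := u - c • mono2 (-1) with hu'
  have hu : u = u' + c • mono2 (-1) := by rw [hu', sub_add_cancel]
  -- The only coefficient of h e^{-iθ} at a negative frequency that could survive is h(0), at
  -- frequency -1.
  have hz : (h • mono2 (-1) : L2) ∈ H2 := by
    rw [smul_mono2]
    refine mem_H2_iff_inner.2 fun n hn => ?_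
    rw [inner_mono2_monoInf_smul]
    rcases eq_or_ne n (-1) with rfl | h1
    · exact h0
    · exact mem_H2_iff_inner.1 hh _ (by omega)
  have h1 : H2ᗮ.starProjection (h • u : L2) = H2ᗮ.starProjection (h • u' : L2) := by
    rw [hu, smul_add_L2, smul_smul_L2, map_add, map_smul, starProjection_orthogonal_eq_zero hz,
      smul_zero, add_zero]
  have horth : inner ℂ u' (c • mono2 (-1)) = 0 := by
    rw [inner_smul_right, ← inner_conj_symm, hu', inner_sub_right, inner_smul_right,
      inner_self_eq_norm_sq_to_K, norm_mono2, ← hc]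
    simp
  have h2 : ‖u‖ ^ 2 = ‖u'‖ ^ 2 + ‖c‖ ^ 2 := by
    have := norm_add_sq_eq_norm_sq_add_norm_sq_of_inner_eq_zero _ _ horth
    rw [← hu, norm_smul, norm_mono2, mul_one] at this
    simpa only [sq] using this
  rw [h1, h2, add_sub_cancel_right]
  gcongr
  exact norm_starProjection_smul_le hn u'

section CowenForm

/-! Symbols `φ = f + conj g` with `g = T_{conj h} f`, where `g` is taken bounded. -/

variable {f g h : Linf}

/-- Because g is the H² part of h̄ f, the difference ḡ - h f̄ is minus the conjugate of the (H²)ᗮ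
part of h̄ f. It has only positive frequencies, and it is bounded because g, h and f are. -/
theorem exists_mem_Hinf_star_eq
    (hgf : toL2 g = H2.starProjection (star h • toL2 f : L2)) :
    ∃ w ∈ Hinf, star g = w + (h • star f : Linf) := by
  refine ⟨star g - (h • star f : Linf), ?_, by rw [sub_add_cancel]⟩
  set v : L2 := star h • toL2 f with hv
  have h1 : toL2 (star g - (h • star f : Linf)) + star v = star (toL2 g) := by
    rw [hv, star_smul_L2, star_star, ← toL2_star, ← toL2_star, ← toL2_smul, ← toL2_add,
      sub_add_cancel]
  have h2 : star (H2ᗮ.starProjection v) + toL2 (star g - (h • star f : Linf)) = 0 := by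
    have h3 : v = toL2 g + H2ᗮ.starProjection v := by
      rw [hgf, H2.starProjection_add_starProjection_orthogonal]
    rw [h3, star_add_Lp, add_left_comm] at h1
    rw [add_comm]
    simpa using h1
  refine mem_H2_iff_inner.2 fun n hn => ?_
  rw [eq_neg_of_add_eq_zero_right h2, inner_neg_right, neg_eq_zero, ← star_star (mono2 n),
    inner_star_L2, star_mono2, ← inner_conj_symm,
    mem_H2_orthogonal_iff_inner.1 (H2ᗮ.starProjection_apply_mem v) _ (by omega), map_zero]

/-- Modulo H², φ̄ p is u = Q(f̄ p) and φ p is h u. The loss in passing from u to Q(h u) is at least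
the squared e^{-iθ} coefficient of u, which is a pairing of p with e^{-iθ} f. -/
theorem sq_norm_inner_le_commForm (hf : f ∈ Hinf) (hg : g ∈ Hinf) (hh : h ∈ Hinf)
    (hgf : toL2 g = H2.starProjection (star h • toL2 f : L2)) (hn : ‖h‖ ≤ 1)
    (h0 : inner ℂ (mono2 0) (toL2 h) = 0) (p : H2) :
    ‖inner ℂ (monoInf (-1) • toL2 f : L2) (p : L2)‖ ^ 2 ≤ commForm (toeplitz (f + star g)) p := by
  obtain ⟨w, hw, hwg⟩ := exists_mem_Hinf_star_eq hgf
  set v : L2 := star f • (p : L2) with hv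
  set u := H2ᗮ.starProjection v with hu
  have h1 : H2ᗮ.starProjection (star (f + star g) • (p : L2)) = u := by
    rw [star_add_Lp, star_star, add_smul_L2, map_add,
      starProjection_orthogonal_eq_zero (smul_mem_H2 hg p.2), add_zero]
  have h2 : H2ᗮ.starProjection ((f + star g) • (p : L2)) = H2ᗮ.starProjection (h • u : L2) := by
    have hvu : v = H2.starProjection v + u := by
      rw [H2.starProjection_add_starProjection_orthogonal]
    rw [hwg, add_smul_L2, add_smul_L2, map_add, map_add,
      starProjection_orthogonal_eq_zero (smul_mem_H2 hf p.2),
      starProjection_orthogonal_eq_zero (smul_mem_H2 hw p.2), zero_add, zero_add, smul_assoc_L2,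
      ← hv]
    conv_lhs => rw [hvu]
    rw [smul_add_L2, map_add, starProjection_orthogonal_eq_zero
      (smul_mem_H2 hh (H2.starProjection_apply_mem v)), zero_add]
  have h3 : inner ℂ (mono2 (-1)) u = inner ℂ (monoInf (-1) • toL2 f : L2) (p : L2) := by
    rw [← smul_mono2, inner_smul_left_L2, ← hv, hu, ← Submodule.inner_starProjection_left_eq_right,
      Submodule.starProjection_eq_self_iff.2 (mono2_mem_H2_orthogonal (by omega))]
  rw [commForm_toeplitz, h1, h2, ← h3]
  linarith [norm_sq_starProjection_smul_le hh hn h0 u]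

/-- The backward shift of `f`. -/
theorem exists_backwardShift (hf : f ∈ Hinf) :
    ∃ F : H2, (monoInf (-1) • toL2 f : L2) = F + inner ℂ (mono2 0) (toL2 f) • mono2 (-1) ∧
      ‖F‖ = ‖toL2 f - inner ℂ (mono2 0) (toL2 f) • mono2 0‖ := by
  set c := inner ℂ (mono2 0) (toL2 f) with hc
  set v := toL2 f - c • mono2 0 with hv
  have hF : (monoInf (-1) • v : L2) ∈ H2 := by
    refine mem_H2_iff_inner.2 fun n hn => ?_
    rw [inner_mono2_monoInf_smul, hv, inner_sub_right, inner_smul_right]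
    rcases eq_or_ne n (-1) with rfl | h1
    · norm_num [norm_mono2, inner_self_eq_norm_sq_to_K]
      rw [← hc, sub_self]
    · rw [mem_H2_iff_inner.1 hf _ (by omega), orthonormal_mono2.2 (by omega : n - -1 ≠ 0)]
      simp
  refine ⟨⟨_, hF⟩, ?_, norm_monoInf_smul _ _⟩
  have h1 : toL2 f = v + c • mono2 0 := by rw [hv, sub_add_cancel]
  conv_lhs => rw [h1]
  rw [smul_add_L2, smul_smul_L2, monoInf_smul_mono2, add_zero]

/-- The conjugate of g has no positive frequencies, so P sees only its mean, and subtracting φ(0)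
removes that mean together with f(0). -/
theorem rieszProj_sub_const (hf : f ∈ Hinf) (hg : g ∈ Hinf) :
    (rieszProj (toL2 (f + star g)) : L2) - Lp.const 2 arc (poissonExt (f + star g : Linf) 0)
      = toL2 f - inner ℂ (mono2 0) (toL2 f) • mono2 0 := by
  set d := inner ℂ (mono2 0) (toL2 (star g)) with hd
  have h1 : H2.starProjection (toL2 (star g)) = d • mono2 0 := by
    refine (Submodule.eq_starProjection_of_mem_orthogonal
      (H2.smul_mem d (mono2_mem_H2 le_rfl)) ?_)
    refine mem_H2_orthogonal_iff_inner.2 fun n hn => ?_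
    rw [inner_sub_right, inner_smul_right]
    rcases eq_or_ne n 0 with rfl | h2
    · rw [inner_self_eq_norm_sq_to_K, norm_mono2, ← hd]
      simp
    · rw [orthonormal_mono2.2 h2, toL2_star, ← star_star (mono2 n), inner_star_L2, star_mono2,
        ← inner_conj_symm, mem_H2_iff_inner.1 hg _ (by omega)]
      simp
  have h2 : (rieszProj (toL2 (f + star g)) : L2) = toL2 f + d • mono2 0 := by
    rw [← h1, toL2_add, map_add, Submodule.coe_add]
    congr 1
    exact Submodule.starProjection_eq_self_iff.2 hf
  rw [h2, poissonExt_zero, const_eq_smul_mono2, toL2_add, inner_add_right, ← hd]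
  module

end CowenForm

theorem monoInf_mem_Hinf {n : ℤ} (hn : 0 ≤ n) : monoInf n ∈ Hinf := by
  have h : toL2 (monoInf n) = mono2 n := by
    ext1
    filter_upwards [coeFn_toL2 (monoInf n), coeFn_monoInf n, coeFn_mono2 n] with t h1 h2 h3
    rw [h1, h2, h3]
  change toL2 (monoInf n) ∈ H2
  rw [h]
  exact mono2_mem_H2 hn

theorem coe_toeplitz_of_mem_Hinf {φ : Linf} (hφ : φ ∈ Hinf) (p : H2) :
    (toeplitz φ p : L2) = φ • (p : L2) :=
  Submodule.starProjection_eq_self_iff.2 (smul_mem_H2 hφ p.2)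

theorem adjoint_toeplitz_monoInf_one :
    adjoint (toeplitz (monoInf 1)) ⟨mono2 0, mono2_mem_H2 le_rfl⟩ = 0 := by
  refine ext_inner_right ℂ fun q => ?_
  rw [adjoint_inner_left, Submodule.coe_inner, coe_toeplitz_of_mem_Hinf (monoInf_mem_Hinf one_pos.le),
    inner_mono2_monoInf_smul, mem_H2_iff_inner.1 q.2 _ (by omega), inner_zero_left]

/-- Putnam's inequality for hyponormal operators on `H²`. -/
theorem putnam_inequality_H2 (T : H2 →L[ℂ] H2) (hT : ∀ x, 0 ≤ commForm T x) (x : H2)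
    (hx : ‖x‖ = 1) : ENNReal.ofReal (Real.pi * commForm T x) ≤ volume (spectrum ℂ T) :=
  -- The unilateral shift serves as the non-unitary isometry; its adjoint kills the constant 1.
  putnam_inequality T hT (toeplitz (monoInf 1))
    (fun v => by
      rw [Submodule.coe_norm, coe_toeplitz_of_mem_Hinf (monoInf_mem_Hinf one_pos.le),
        norm_monoInf_smul, Submodule.coe_norm])
    ⟨mono2 0, mono2_mem_H2 le_rfl⟩ (norm_mono2 0) adjoint_toeplitz_monoInf_one x hx

end

end HardyToeplitz

open HardyToeplitz in
theorem mainTheorem2 (φ : Linf) (f h : Hinf)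
    (hnorm : ‖(h : Linf)‖ ≤ 1) (hzero : poissonExt (h : Linf) 0 = 0)
    (hφ : toL2 φ = Hinf.toH2 f + star (toeplitz (star (h : Linf)) (Hinf.toH2 f) : L2)) :
    ENNReal.ofReal (Real.pi * ‖(rieszProj (toL2 φ) : L2) - Lp.const 2 arc (poissonExt φ 0)‖ ^ 2)
      ≤ volume (spectrum ℂ (toeplitz φ)) := by
  obtain ⟨f, hf⟩ := f
  obtain ⟨h, hh⟩ := h
  -- T_{h̄} f is a priori only in H²; defining g as the conjugate of φ - f makes it bounded from the
  -- start.
  obtain ⟨g, rfl⟩ : ∃ g : Linf, φ = f + star g := ⟨star (φ - f), by rw [star_star]; abel⟩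
  have hgf : toL2 g = H2.starProjection (star h • toL2 f : L2) := by
    rw [toL2_add, toL2_star] at hφ
    exact star_injective (add_left_cancel hφ)
  have hg : g ∈ Hinf := by
    change toL2 g ∈ H2
    rw [hgf]
    exact H2.starProjection_apply_mem _
  rw [poissonExt_zero] at hzero
  have hform := sq_norm_inner_le_commForm hf hg hh hgf hnorm hzero
  obtain ⟨F, hF, hFn⟩ := exists_backwardShift hf
  rw [rieszProj_sub_const hf hg, ← hFn]
  rcases eq_or_ne F 0 with h0 | h0
  · simp [h0]
  have hFpos : 0 < ‖F‖ := norm_pos_iff.2 h0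
  set x : H2 := ((‖F‖⁻¹ : ℝ) : ℂ) • F with hx
  have hxn : ‖x‖ = 1 := by
    rw [hx, norm_smul, Complex.norm_real, norm_inv, norm_norm, inv_mul_cancel₀ hFpos.ne']
  refine le_trans (ENNReal.ofReal_le_ofReal (mul_le_mul_of_nonneg_left ?_ Real.pi_pos.le))
    (putnam_inequality_H2 _ (fun y => (sq_nonneg _).trans (hform y)) x hxn)
  -- At x = F/‖F‖ the lower bound equals ‖F‖²: the e^{-iθ} term of e^{-iθ} f is orthogonal to F ∈
  -- H².
  refine le_trans (le_of_eq ?_) (hform x)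
  have hort : inner ℂ (mono2 (-1)) (F : L2) = 0 := mem_H2_iff_inner.1 F.2 _ (by omega)
  rw [hF, hx, Submodule.coe_smul, inner_smul_right, inner_add_left, inner_smul_left, hort,
    inner_self_eq_norm_sq_to_K, mul_zero, add_zero, norm_mul, Complex.norm_real, norm_inv,
    norm_norm, norm_pow]
  simp only [RCLike.norm_ofReal, abs_norm, Submodule.coe_norm]
  field_simp
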